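/- Let $k,n\ge 1$ and let $\mathbb{T}^n=\mathbb{R}^n/\mathbb{Z}^n$ with its usual metric. Let $A_1,\dots,A_k$ be pairwise different non-singular integer $n\times n$ matrices all of whose (complex) eigenvalues have modulus greater than $1$, and let $T:\mathbb{Z}_+^k\to C^0(\mathbb{T}^n,\mathbb{T}^n)$ be a $\mathbb{Z}_+^k$-action (so $T^0=\mathrm{id}$ and $T^{u+v}=T^u\circ T^v$; in particular the generators commute) whose $i$-th generator $T_i$ is the endomorphism $x\mapsto A_ix \pmod{\mathbb{Z}^n}$ of $\mathbb{T}^n$. Let $$X_T=\bigl\{(x_m)_{m\ge 0}\in(\mathbb{T}^n)^{\mathbb{Z}_+} : \text{for every } m\ge 0 \text{ there is } i\in\{1,\dots,k\} \text{ with } T_i(x_m)=x_{m+1}\bigr\}$$ with the metric $d(\bar x,\bar y)=\sum_{m\ge 0}2^{-m}d_{\mathbb{T}^n}(x_m,y_m)$, let $\sigma_T:X_T\to X_T$, $(x_m)_m\mapsto(x_{m+1})_m$, be the shift, and let $h(T)$ be the topological entropy of $\sigma_T$, that is, $$h(T)=\lim_{\varepsilon\to 0}\limsup_{N\to\infty}\frac1N\log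 r(\sigma_T,N,\varepsilon),$$ where $r(\sigma_T,N,\varepsilon)$ is the least cardinality of a set $E\subset X_T$ such that every $\bar x\in X_T$ has some $\bar y\in E$ with $d(\sigma_T^j\bar x,\sigma_T^j\bar y)\le\varepsilon$ for $0\le j\le N-1$. Then $$h(T)\le\log\Bigl(\sum_{i=1}^k\prod_{j=1}^n|\lambda_i^{(j)}|\Bigr)=\log\Bigl(\sum_{i=1}^k|\det A_i|\Bigr),$$ where $\lambda_i^{(1)},\dots,\lambda_i^{(n)}$ are the eigenvalues of $A_i$ counted with algebraic multiplicity. -/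

import Mathlib

noncomputable section

/-- A continuous `ℤ₊ᵏ`-action on `X`: a map `T : ℤ₊ᵏ → C⁰(X, X)` with `T 0 = id` and
`T (u + v) = T u ∘ T v`. In particular the maps `T u` commute pairwise. -/
structure ZPlusAction (k : ℕ) (X : Type*) [TopologicalSpace X] where
  /-- The map `Tᵘ` for `u ∈ ℤ₊ᵏ`. -/
  toFun : (Fin k → ℕ) → C(X, X)
  map_zero : toFun 0 = ContinuousMap.id X
  map_add : ∀ u v : Fin k → ℕ, toFun (u + v) = (toFun u).comp (toFun v)

/-- The generators `T_i = T(0, …, 0, 1, 0, …, 0)` (the `1` at place `i`) of an action. -/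
def ZPlusAction.generator {k : ℕ} {X : Type*} [TopologicalSpace X] (T : ZPlusAction k X)
    (i : Fin k) : C(X, X) :=
  T.toFun (Pi.single i 1)

/-- The orbit space `X_T`: all sequences `(x_m)` in `X` such that for every `m` some generator
`T_i` maps `x_m` to `x_{m+1}`. -/
@[ext]
structure OrbitSpace {k : ℕ} {X : Type*} [TopologicalSpace X] (T : ZPlusAction k X) where
  /-- The underlying sequence of points of `X`. -/
  seq : ℕ → X
  step : ∀ m : ℕ, ∃ i : Fin k, T.generator i (seq m) = seq (m + 1)

namespace OrbitSpace

/-- The shift `σ_T : X_T → X_T`, `(x_m)_m ↦ (x_{m+1})_m`. -/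
def shift {k : ℕ} {X : Type*} [TopologicalSpace X] (T : ZPlusAction k X) :
    OrbitSpace T → OrbitSpace T :=
  fun x => ⟨fun m => x.seq (m + 1), fun m => x.step (m + 1)⟩

theorem summable_dist {X : Type*} [MetricSpace X] [CompactSpace X] (x y : ℕ → X) :
    Summable fun m : ℕ => dist (x m) (y m) / 2 ^ m := by
  refine Summable.of_nonneg_of_le (fun m => by positivity) (fun m => ?_)
    (summable_geometric_two.mul_left (Metric.diam (Set.univ : Set X)))
  have h : dist (x m) (y m) ≤ Metric.diam (Set.univ : Set X) :=
    Metric.dist_le_diam_of_mem isCompact_univ.isBounded (Set.mem_univ _) (Set.mem_univ _)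
  rw [div_eq_mul_one_div, one_div_pow]
  exact mul_le_mul_of_nonneg_right h (by positivity)

/-- The metric `d(x, y) = ∑ₘ d_X(x_m, y_m) / 2 ^ m` on the orbit space. -/
instance {k : ℕ} {X : Type*} [MetricSpace X] [CompactSpace X] (T : ZPlusAction k X) :
    MetricSpace (OrbitSpace T) where
  dist x y := ∑' m : ℕ, dist (x.seq m) (y.seq m) / 2 ^ m
  dist_self x := by simp
  dist_comm x y := by simp only [dist_comm]
  dist_triangle x y z := by
    rw [← (summable_dist x.seq y.seq).tsum_add (summable_dist y.seq z.seq)]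
    refine (summable_dist x.seq z.seq).tsum_le_tsum (fun m => ?_)
      ((summable_dist x.seq y.seq).add (summable_dist y.seq z.seq))
    rw [← add_div]
    exact div_le_div_of_nonneg_right (dist_triangle _ _ _) (by positivity)
  eq_of_dist_eq_zero := by
    intro x y h
    have h0 := (hasSum_zero_iff_of_nonneg
      (fun m => div_nonneg dist_nonneg (by positivity))).1
      (h ▸ (summable_dist x.seq y.seq).hasSum)
    ext m
    have hm := congrFun h0 m
    simpa using hm

end OrbitSpace

/-- Friedland's topological entropy `h(T)` of a `ℤ₊ᵏ`-action: the (Bowen) topological entropy of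
the shift `σ_T` on the orbit space `X_T`. It is the supremum over entourages (equivalently the
limit as `ε → 0`) of the exponential growth rate `limsup (1/n) log r(σ_T, n, ε)` of the minimal
cardinality of `(σ_T, n, ε)`-spanning sets of `X_T`. -/
def friedlandEntropy {k : ℕ} {X : Type*} [MetricSpace X] [CompactSpace X]
    (T : ZPlusAction k X) : EReal :=
  Dynamics.coverEntropy (OrbitSpace.shift T) Set.univ

/-- The endomorphism of `𝕋ⁿ = ℝⁿ/ℤⁿ` induced by an integer matrix `A`: `x ↦ A x mod ℤⁿ`. -/
def torusEndomorphism {n : ℕ} (A : Matrix (Fin n) (Fin n) ℤ) :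
    UnitAddTorus (Fin n) → UnitAddTorus (Fin n) :=
  fun x i => ∑ j, A i j • x j

/-- The complex eigenvalues of an integer matrix, counted with algebraic multiplicity. -/
def complexEigenvalues {n : ℕ} (A : Matrix (Fin n) (Fin n) ℤ) : Multiset ℂ :=
  (A.map (Int.cast : ℤ → ℂ)).charpoly.roots

end

/-!
An itinerary `s` makes an orbit linear: `x_m = B_m x_0` with `B_m = A_{s (m-1)} ⋯ A_{s 0}`. Code a
point `x_0 = p mod ℤⁿ` by the class of `⌊K B_M p⌋` modulo `K B_M ℤⁿ`; there are `Kⁿ |det B_M|`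
such classes. Two points with the same code differ by some `u` with `‖B_M u‖ ≤ 1 / K`, and then
every `B_m u` with `m ≤ M` is small: the `A_i` commute and have no eigenvalue inside the unit disc,
so inverses of words of length `m` have norm at most `C r ^ m`, for any `r > 1`. Hence a set of
orbits with itinerary `s` that is separated up to time `M` has at most `Kⁿ ∏ |det A_{s j}|`
elements, with `K` of order `r ^ M`. Summing over the itineraries gives `(∑ |det A_i|) ^ M` up to
a factor `c r ^ (n M)`; finally let `r → 1`.
-/

open Filter Topology Matrix
open scoped ENNReal NNReal

section GrowthOfProducts

variable {R ι : Type*} [NormedRing R]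

theorem exists_norm_pow_le_mul_pow [NormedAlgebra ℂ R] [CompleteSpace R] {a : R} {r : ℝ≥0}
    (ha : spectralRadius ℂ a < r) : ∃ C : ℝ, ∀ m : ℕ, ‖a ^ m‖ ≤ C * r ^ m := by
  have hr : r ≠ 0 := by rintro rfl; simp at ha
  have hev : ∀ᶠ m : ℕ in atTop, ‖a ^ m‖ ≤ 1 * ‖(r : ℝ) ^ m‖ := by
    filter_upwards [(spectrum.gelfand_formula a).eventually_lt_const ha, eventually_gt_atTop 0]
      with m hm hm0
    rw [one_div, ENNReal.rpow_inv_lt_iff (by positivity), ENNReal.rpow_natCast] at hm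
    simpa using mod_cast hm.le
  obtain ⟨C, -, hC⟩ := Asymptotics.bound_of_isBigO_nat_atTop (Asymptotics.IsBigO.of_bound 1 hev)
  exact ⟨C, fun m => by simpa using hC (pow_ne_zero m (NNReal.coe_ne_zero.2 hr))⟩

theorem spectralRadius_units_inv_le_one [NormedAlgebra ℂ R] {u : Rˣ}
    (h : ∀ μ ∈ spectrum ℂ (u : R), 1 ≤ ‖μ‖) : spectralRadius ℂ (↑u⁻¹ : R) ≤ 1 := by
  refine iSup₂_le fun z hz => ?_
  have hz0 : z ≠ 0 := spectrum.ne_zero_of_mem_of_unit hz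
  have hinv := h z⁻¹ (spectrum.inv₀_mem_iff.2 hz)
  rw [norm_inv, one_le_inv₀ (norm_pos_iff.2 hz0)] at hinv
  exact_mod_cast hinv

theorem prod_map_eq_pow_count_mul_prod_filter_ne {M : Type*} [Monoid M] [DecidableEq ι] {a : ι → M}
    (hcomm : ∀ i j, Commute (a i) (a j)) (i : ι) (l : List ι) :
    (l.map a).prod = a i ^ l.count i * ((l.filter (· ≠ i)).map a).prod := by
  induction l with
  | nil => simp
  | cons j l ih =>
    by_cases hji : j = i
    · subst hji
      simp [ih, pow_succ', mul_assoc]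
    · simp [ih, hji, ← mul_assoc, ((hcomm j i).pow_right _).eq]

theorem exists_norm_prod_map_le_mul_pow [Finite ι] {a : ι → R}
    (hcomm : ∀ i j, Commute (a i) (a j)) {r : ℝ} (hpow : ∀ i, ∃ C, ∀ m : ℕ, ‖a i ^ m‖ ≤ C * r ^ m) :
    ∃ C, ∀ l : List ι, ‖(l.map a).prod‖ ≤ C * r ^ l.length := by
  classical
  have := Fintype.ofFinite ι
  suffices h : ∀ S : Finset ι, ∃ C, ∀ l : List ι, (∀ i ∈ l, i ∈ S) →
      ‖(l.map a).prod‖ ≤ C * r ^ l.length by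
    simpa using h Finset.univ
  intro S
  induction S using Finset.induction_on with
  | empty =>
    refine ⟨‖(1 : R)‖, fun l hl => ?_⟩
    obtain rfl : l = [] := List.eq_nil_iff_forall_not_mem.2 fun i hi => by simpa using hl i hi
    simp
  | insert i S _ ih =>
    obtain ⟨C, hC⟩ := ih
    obtain ⟨D, hD⟩ := hpow i
    refine ⟨D * C, fun l hl => ?_⟩
    have hfilter : ‖((l.filter (· ≠ i)).map a).prod‖ ≤ C * r ^ (l.filter (· ≠ i)).length :=
      hC _ fun j hj => by
        obtain ⟨hjl, hji⟩ := List.mem_filter.1 hj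
        exact (Finset.mem_insert.1 (hl j hjl)).resolve_left (by simpa using hji)
    have hlength : l.count i + (l.filter (· ≠ i)).length = l.length := by
      simpa [List.count_eq_length_filter, beq_eq_decide] using
        (l.length_eq_length_filter_add (· == i)).symm
    calc ‖(l.map a).prod‖ = ‖a i ^ l.count i * ((l.filter (· ≠ i)).map a).prod‖ := by
          rw [← prod_map_eq_pow_count_mul_prod_filter_ne hcomm]
      _ ≤ (D * r ^ l.count i) * (C * r ^ (l.filter (· ≠ i)).length) :=
          (norm_mul_le _ _).trans (mul_le_mul (hD _) hfilter (norm_nonneg _)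
            ((norm_nonneg _).trans (hD _)))
      _ = D * C * r ^ l.length := by rw [← hlength, pow_add]; ring

end GrowthOfProducts

section WordProd

variable {ι R : Type*} [Monoid R]

/-- The product `a_{s (m-1)} ⋯ a_{s 1} a_{s 0}` spelled by the first `m` letters of `s`. The first
letter stands on the right, as in a composition of maps. -/
def wordProd (a : ι → R) (s : ℕ → ι) (m : ℕ) : R :=
  ((List.range m).map fun j => a (s j)).reverse.prod

variable (a : ι → R) (s : ℕ → ι)

@[simp]
theorem wordProd_zero : wordProd a s 0 = 1 := rfl

theorem wordProd_succ (m : ℕ) : wordProd a s (m + 1) = a (s m) * wordProd a s m := by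
  simp [wordProd, List.range_succ]

theorem wordProd_add (m l : ℕ) :
    wordProd a s (m + l) = wordProd a (fun j => s (m + j)) l * wordProd a s m := by
  simp [wordProd, List.range_add, Function.comp_def]

theorem map_wordProd {S F : Type*} [Monoid S] [FunLike F R S] [MonoidHomClass F R S] (φ : F)
    (m : ℕ) :
    φ (wordProd a s m) = wordProd (fun i => φ (a i)) s m := by
  simp [wordProd, map_list_prod, Function.comp_def]

theorem wordProd_eq_prod_range {M : Type*} [CommMonoid M] (a : ι → M) (s : ℕ → ι) (m : ℕ) :
    wordProd a s m = ∏ j ∈ Finset.range m, a (s j) := by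
  induction m with
  | zero => simp
  | succ m ih => rw [wordProd_succ, ih, Finset.prod_range_succ, mul_comm]

theorem inv_wordProd {n : ℕ} (A : ι → Matrix (Fin n) (Fin n) ℂ) (s : ℕ → ι) (m : ℕ) :
    (wordProd A s m)⁻¹ = (((List.range m).map s).map fun i => (A i)⁻¹).prod := by
  rw [wordProd, Matrix.list_prod_inv_reverse, List.reverse_reverse, List.map_map, List.map_map]
  rfl

end WordProd

section Expansion

variable {ι : Type*} {n : ℕ}

attribute [local instance] Matrix.linftyOpNormedAddCommGroup Matrix.linftyOpNormedRing
  Matrix.linftyOpNormedAlgebra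

theorem exists_norm_le_mul_norm_wordProd_mulVec [Finite ι] {A : ι → Matrix (Fin n) (Fin n) ℂ}
    (hcomm : ∀ i j, Commute (A i) (A j)) (hspec : ∀ i, ∀ μ ∈ spectrum ℂ (A i), 1 ≤ ‖μ‖)
    {r : ℝ≥0} (hr : 1 < r) :
    ∃ C : ℝ, ∀ (s : ℕ → ι) (m : ℕ) (v : Fin n → ℂ), ‖v‖ ≤ C * r ^ m * ‖wordProd A s m *ᵥ v‖ := by
  have hunit : ∀ i, IsUnit (A i) := fun i =>
    spectrum.zero_notMem_iff ℂ |>.1 fun h0 => by simpa using (hspec i 0 h0).trans_lt' one_pos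
  have hpow : ∀ i, ∃ C, ∀ m : ℕ, ‖(A i)⁻¹ ^ m‖ ≤ C * (r : ℝ) ^ m := fun i => by
    obtain ⟨u, hu⟩ := hunit i
    rw [← hu, ← coe_units_inv]
    exact exists_norm_pow_le_mul_pow ((spectralRadius_units_inv_le_one (hu ▸ hspec i)).trans_lt
      (by exact_mod_cast hr))
  have hcomm_inv : ∀ i j, Commute (A i)⁻¹ (A j)⁻¹ := fun i j => by
    rw [commute_iff_eq, ← Matrix.mul_inv_rev, ← Matrix.mul_inv_rev, (hcomm i j).eq]
  obtain ⟨C, hC⟩ := exists_norm_prod_map_le_mul_pow hcomm_inv hpow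
  refine ⟨C, fun s m v => ?_⟩
  have hdet : IsUnit (wordProd A s m).det := by
    rw [← coe_detMonoidHom, map_wordProd, wordProd_eq_prod_range]
    exact Finset.prod_induction _ IsUnit (fun _ _ => IsUnit.mul) isUnit_one
      fun j _ => (isUnit_iff_isUnit_det _).1 (hunit (s j))
  have hinv : ‖(wordProd A s m)⁻¹‖ ≤ C * r ^ m := by
    simpa [inv_wordProd] using hC ((List.range m).map s)
  calc ‖v‖ = ‖(wordProd A s m)⁻¹ *ᵥ (wordProd A s m *ᵥ v)‖ := by
        rw [mulVec_mulVec, nonsing_inv_mul _ hdet, one_mulVec]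
    _ ≤ ‖(wordProd A s m)⁻¹‖ * ‖wordProd A s m *ᵥ v‖ := linfty_opNorm_mulVec _ _
    _ ≤ C * r ^ m * ‖wordProd A s m *ᵥ v‖ := mul_le_mul_of_nonneg_right hinv (norm_nonneg _)

/-- An integer matrix viewed as a matrix over `R`. -/
abbrev castMatrix (R : Type*) [Ring R] : Matrix (Fin n) (Fin n) ℤ →+* Matrix (Fin n) (Fin n) R :=
  (Int.castRingHom R).mapMatrix

theorem mem_spectrum_castMatrix_iff {A : Matrix (Fin n) (Fin n) ℤ} {μ : ℂ} :
    μ ∈ spectrum ℂ (castMatrix ℂ A) ↔ μ ∈ complexEigenvalues A :=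
  mem_spectrum_iff_isRoot_charpoly.trans
    (Polynomial.mem_roots (castMatrix ℂ A).charpoly_monic.ne_zero).symm

theorem castMatrix_mulVec_ofReal (B : Matrix (Fin n) (Fin n) ℤ) (v : Fin n → ℝ) :
    castMatrix ℂ B *ᵥ (fun i => (v i : ℂ)) = fun i => ((castMatrix ℝ B *ᵥ v) i : ℂ) := by
  ext i
  simp [mulVec, dotProduct]

theorem norm_ofReal_comp (v : Fin n → ℝ) : ‖fun i => (v i : ℂ)‖ = ‖v‖ := by
  simp [Pi.norm_def]

theorem exists_norm_le_mul_norm_castMatrix_wordProd_mulVec [Finite ι]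
    {A : ι → Matrix (Fin n) (Fin n) ℤ} (hcomm : ∀ i j, Commute (A i) (A j))
    (hexp : ∀ i, ∀ μ ∈ complexEigenvalues (A i), 1 ≤ ‖μ‖) {r : ℝ≥0} (hr : 1 < r) :
    ∃ C : ℝ, ∀ (s : ℕ → ι) (m : ℕ) (v : Fin n → ℝ),
      ‖v‖ ≤ C * r ^ m * ‖castMatrix ℝ (wordProd A s m) *ᵥ v‖ := by
  obtain ⟨C, hC⟩ := exists_norm_le_mul_norm_wordProd_mulVec
    (A := fun i => castMatrix ℂ (A i)) (fun i j => (hcomm i j).map (castMatrix ℂ))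
    (fun i μ hμ => hexp i μ (mem_spectrum_castMatrix_iff.1 hμ)) hr
  refine ⟨C, fun s m v => ?_⟩
  have hword : castMatrix ℂ (wordProd A s m) = wordProd (fun i => castMatrix ℂ (A i)) s m :=
    map_wordProd A s (castMatrix ℂ) m
  simpa only [← hword, castMatrix_mulVec_ofReal, norm_ofReal_comp] using hC s m fun i => v i

end Expansion

section Determinant

variable {n : ℕ} (A : Matrix (Fin n) (Fin n) ℤ)

theorem prod_norm_complexEigenvalues :
    ((complexEigenvalues A).map fun μ => ‖μ‖).prod = |(A.det : ℝ)| := by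
  have hdet : (complexEigenvalues A).prod = (A.det : ℂ) :=
    (det_eq_prod_roots_charpoly (castMatrix ℂ A)).symm.trans ((Int.castRingHom ℂ).map_det A).symm
  rw [← Complex.norm_intCast, ← hdet]
  exact (map_multiset_prod (normHom : ℂ →*₀ ℝ) _).symm

theorem det_ne_zero_of_zero_notMem_complexEigenvalues (hA : 0 ∉ complexEigenvalues A) :
    A.det ≠ 0 := by
  intro hdet
  have hprod := prod_norm_complexEigenvalues A
  rw [hdet, Int.cast_zero, abs_zero, Multiset.prod_eq_zero_iff] at hprod
  simp_all

theorem card_quotient_range_toLin' (hA : A.det ≠ 0) :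
    Nat.card ((Fin n → ℤ) ⧸ LinearMap.range A.toLin') = A.det.natAbs := by
  have hinj : Function.Injective A.toLin' := LinearMap.ker_eq_bot.1 <|
    ker_toLin'_eq_bot_iff.2 fun _ => eq_zero_of_mulVec_eq_zero hA
  have := Submodule.natAbs_det_equiv _ (LinearEquiv.ofInjective A.toLin' hinj)
  rw [← LinearMap.det_toLin', ← this]
  rfl

theorem natAbs_det_natCast_smul_wordProd {ι : Type*} (A : ι → Matrix (Fin n) (Fin n) ℤ)
    (s : ℕ → ι) (K M : ℕ) :
    ((K : ℤ) • wordProd A s M).det.natAbs =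
      K ^ n * ∏ j ∈ Finset.range M, (A (s j)).det.natAbs := by
  have hdet : (wordProd A s M).det = ∏ j ∈ Finset.range M, (A (s j)).det :=
    (map_wordProd A s detMonoidHom M).trans (wordProd_eq_prod_range _ s M)
  rw [det_smul, hdet, Int.natAbs_mul, Int.natAbs_pow, Fintype.card_fin, Int.natAbs_natCast]
  exact congrArg _ (map_prod Int.natAbsHom _ _)

end Determinant

section Torus

variable {n : ℕ}

/-- The covering homomorphism `ℝⁿ → 𝕋ⁿ = ℝⁿ/ℤⁿ`. -/
def torusProj (n : ℕ) : (Fin n → ℝ) →+ UnitAddTorus (Fin n) :=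
  (QuotientAddGroup.mk' (AddSubgroup.zmultiples (1 : ℝ))).compLeft (Fin n)

theorem torusProj_surjective : Function.Surjective (torusProj n) := fun x =>
  ⟨fun i => (QuotientAddGroup.mk_surjective (x i)).choose,
    funext fun i => (QuotientAddGroup.mk_surjective (x i)).choose_spec⟩

theorem torusProj_intCast (q : Fin n → ℤ) : torusProj n (fun i => (q i : ℝ)) = 0 :=
  funext fun i => AddCircle.coe_eq_zero_iff (p := (1 : ℝ)).2 ⟨q i, by simp⟩

theorem norm_torusProj_le (v : Fin n → ℝ) : ‖torusProj n v‖ ≤ ‖v‖ :=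
  (pi_norm_le_iff_of_nonneg (norm_nonneg v)).2 fun i =>
    QuotientAddGroup.norm_mk_le_norm.trans (norm_le_pi_norm v i)

theorem torusEndomorphism_torusProj (B : Matrix (Fin n) (Fin n) ℤ) (v : Fin n → ℝ) :
    torusEndomorphism B (torusProj n v) = torusProj n (castMatrix ℝ B *ᵥ v) := by
  ext i
  let π : ℝ →+ UnitAddCircle := QuotientAddGroup.mk' _
  change ∑ j, B i j • π (v j) = π (∑ j, (B i j : ℝ) * v j)
  simp only [map_sum, ← map_zsmul, zsmul_eq_mul]

theorem torusEndomorphism_one : torusEndomorphism (1 : Matrix (Fin n) (Fin n) ℤ) = id := by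
  ext x i
  simp [torusEndomorphism, Matrix.one_apply, ite_smul]

theorem torusEndomorphism_mul (B D : Matrix (Fin n) (Fin n) ℤ) :
    torusEndomorphism (B * D) = torusEndomorphism B ∘ torusEndomorphism D := by
  ext x i
  obtain ⟨v, rfl⟩ := torusProj_surjective x
  simp only [Function.comp_apply, torusEndomorphism_torusProj, map_mul, mulVec_mulVec]

theorem torusEndomorphism_sub (B : Matrix (Fin n) (Fin n) ℤ) (x y : UnitAddTorus (Fin n)) :
    torusEndomorphism B (x - y) = torusEndomorphism B x - torusEndomorphism B y := by
  ext i
  simp [torusEndomorphism, smul_sub]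

theorem eq_of_forall_zsmul_unitAddCircle_eq {a b : ℤ} (h : ∀ x : UnitAddCircle, a • x = b • x) :
    a = b := by
  by_contra hab
  have hdvd := addOrderOf_dvd_iff_zsmul_eq_zero.2 <|
    (sub_zsmul ((1 / ((a - b).natAbs + 1 : ℕ) : ℝ) : UnitAddCircle) a b).trans
      (by rw [h, add_neg_cancel])
  rw [AddCircle.addOrderOf_period_div (Nat.succ_pos _)] at hdvd
  have hle := Nat.le_of_dvd (by omega) (Int.natCast_dvd.1 hdvd)
  omega

theorem torusEndomorphism_injective :
    Function.Injective (torusEndomorphism : Matrix (Fin n) (Fin n) ℤ → _) := by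
  intro A B h
  ext i j
  refine eq_of_forall_zsmul_unitAddCircle_eq fun x => ?_
  simpa [torusEndomorphism, Pi.single_apply] using congrFun (congrFun h (Pi.single j x)) i

theorem exists_coding_mod_range_toLin' (B : Matrix (Fin n) (Fin n) ℤ) {K : ℕ} (hK : K ≠ 0) :
    ∃ c : UnitAddTorus (Fin n) → (Fin n → ℤ) ⧸ LinearMap.range ((K : ℤ) • B).toLin',
      ∀ x y, c x = c y → ∃ u, torusProj n u = x - y ∧ ‖castMatrix ℝ B *ᵥ u‖ ≤ 1 / K := by
  choose p hp using torusProj_surjective (n := n)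
  let f (x : UnitAddTorus (Fin n)) (i : Fin n) : ℝ := K * (castMatrix ℝ B *ᵥ p x) i
  refine ⟨fun x => Submodule.Quotient.mk fun i => ⌊f x i⌋, fun x y hxy => ?_⟩
  obtain ⟨q, hq⟩ := (Submodule.Quotient.eq _).1 hxy
  refine ⟨p x - p y - fun i => (q i : ℝ), by
    rw [map_sub, map_sub, hp, hp, torusProj_intCast, sub_zero], ?_⟩
  refine (pi_norm_le_iff_of_nonneg (by positivity)).2 fun i => ?_
  have hq_i : (K : ℝ) * (castMatrix ℝ B *ᵥ fun i => (q i : ℝ)) i = ⌊f x i⌋ - ⌊f y i⌋ := by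
    rw [toLin'_apply, smul_mulVec] at hq
    simpa [mulVec, dotProduct] using congrArg (Int.cast : ℤ → ℝ) (congrFun hq i)
  have hfract : K * (castMatrix ℝ B *ᵥ (p x - p y - fun i => (q i : ℝ))) i =
      Int.fract (f x i) - Int.fract (f y i) := by
    rw [mulVec_sub, mulVec_sub, Pi.sub_apply, Pi.sub_apply, mul_sub, mul_sub, hq_i,
      Int.fract, Int.fract]
    ring
  rw [le_div_iff₀' (by positivity), ← Real.norm_natCast K, ← norm_mul, hfract, Real.norm_eq_abs]
  exact (Int.abs_sub_lt_one_of_floor_eq_floor (by simp)).le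

end Torus

namespace OrbitSpace

theorem seq_iterate_shift {k : ℕ} {X : Type*} [TopologicalSpace X] {T : ZPlusAction k X}
    (x : OrbitSpace T) (j m : ℕ) :
    ((shift T)^[j] x).seq m = x.seq (j + m) := by
  induction j generalizing x with
  | zero => simp
  | succ j ih => rw [Function.iterate_succ_apply, ih, Nat.add_right_comm]; rfl

variable {k : ℕ} {X : Type*} [MetricSpace X] [CompactSpace X] {T : ZPlusAction k X}

theorem dist_eq_dist_seq_zero_add (x y : OrbitSpace T) :
    dist x y = dist (x.seq 0) (y.seq 0) + dist (shift T x) (shift T y) / 2 := by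
  change ∑' m, _ = _ + (∑' m, dist (x.seq (m + 1)) (y.seq (m + 1)) / 2 ^ m) / 2
  rw [(summable_dist x.seq y.seq).tsum_eq_zero_add, pow_zero, div_one, ← tsum_div_const]
  simp only [pow_succ, div_div]

theorem dist_le_of_forall {x y : OrbitSpace T} {a : ℝ}
    (h : ∀ m, dist (x.seq m) (y.seq m) ≤ a) : dist x y ≤ 2 * a := by
  rw [mul_comm, ← tsum_geometric_two, ← tsum_mul_left]
  refine (summable_dist x.seq y.seq).tsum_le_tsum (fun m => ?_)
    (summable_geometric_two.mul_left a)
  simpa [div_eq_mul_inv] using mul_le_mul_of_nonneg_right (h m) (by positivity : 0 ≤ (2 ^ m : ℝ)⁻¹)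

theorem dist_le_of_forall_lt {δ : ℝ} (hδ : 0 ≤ δ) {L : ℕ} {x y : OrbitSpace T}
    (h : ∀ m < L, dist (x.seq m) (y.seq m) ≤ δ) :
    dist x y ≤ 2 * δ + 2 * Metric.diam (Set.univ : Set X) / 2 ^ L := by
  induction L generalizing x y with
  | zero =>
    have hdiam : dist x y ≤ 2 * Metric.diam (Set.univ : Set X) := dist_le_of_forall fun m =>
      Metric.dist_le_diam_of_mem isCompact_univ.isBounded (Set.mem_univ _) (Set.mem_univ _)
    simpa using hdiam.trans (le_add_of_nonneg_left (by positivity))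
  | succ L ih =>
    have hshift := ih (x := shift T x) (y := shift T y) fun m hm => h (m + 1) (by omega)
    rw [dist_eq_dist_seq_zero_add, pow_succ, ← div_div]
    linarith [h 0 (by omega)]

theorem exists_forall_dist_lt (T : ZPlusAction k X) {ε : ℝ} (hε : 0 < ε) :
    ∃ δ > 0, ∃ L : ℕ, ∀ x y : OrbitSpace T,
      (∀ m < L, dist (x.seq m) (y.seq m) ≤ δ) → dist x y < ε := by
  obtain ⟨L, hL⟩ := (tendsto_const_nhds (x := 2 * Metric.diam (Set.univ : Set X))
    |>.div_atTop (tendsto_pow_atTop_atTop_of_one_lt one_lt_two)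
    |>.eventually_lt_const (half_pos hε)).exists
  refine ⟨ε / 4, by positivity, L, fun x y h => ?_⟩
  linarith [dist_le_of_forall_lt (by positivity) h]

/-- `s` is `δ`-separated up to time `M`: any two distinct orbits of `s` are more than `δ` apart in
`X` at some time before `M`. -/
def IsSeparated (δ : ℝ) (M : ℕ) (s : Set (OrbitSpace T)) : Prop :=
  s.Pairwise fun x y => ∃ m < M, δ < dist (x.seq m) (y.seq m)

theorem exists_isSeparated_of_isDynNetIn (T : ZPlusAction k X) {ε : ℝ} (hε : 0 < ε) :
    ∃ δ > 0, ∃ L, ∀ (N : ℕ) (s : Set (OrbitSpace T)),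
      Dynamics.IsDynNetIn (shift T) Set.univ {p | dist p.1 p.2 < ε} N s →
        IsSeparated δ (N + L) s := by
  obtain ⟨δ, hδ, L, hL⟩ := exists_forall_dist_lt T hε
  refine ⟨δ, hδ, L, fun N s hs x hx y hy hxy => ?_⟩
  by_contra! hclose
  refine Set.not_disjoint_iff.2 ⟨y, Dynamics.mem_dynEntourage.2 fun j hj => ?_,
    Dynamics.mem_dynEntourage.2 fun j _ => ?_⟩ (hs.2 hx hy hxy)
  · refine hL _ _ fun m hm => ?_
    rw [seq_iterate_shift, seq_iterate_shift]
    exact hclose (j + m) (by omega)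
  · simpa using hε

end OrbitSpace

theorem friedlandEntropy_le_log_of_forall_isSeparated {k : ℕ} {X : Type*} [MetricSpace X]
    [CompactSpace X] {T : ZPlusAction k X} {b : ℝ≥0}
    (h : ∀ δ > 0, ∃ c : ℝ≥0, ∀ (M : ℕ) (F : Finset (OrbitSpace T)),
      OrbitSpace.IsSeparated δ M (F : Set (OrbitSpace T)) → (F.card : ℝ≥0) ≤ c * b ^ M) :
    friedlandEntropy T ≤ ENNReal.log b := by
  rw [friedlandEntropy,
    Dynamics.coverEntropy_eq_iSup_basis_netEntropyEntourage Metric.uniformity_basis_dist]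
  refine iSup₂_le fun ε hε => ?_
  obtain ⟨δ, hδ, L, hL⟩ := OrbitSpace.exists_isSeparated_of_isDynNetIn T hε
  obtain ⟨c, hc⟩ := h δ hδ
  rw [← ExpGrowth.expGrowthSup_pow]
  refine ExpGrowth.expGrowthSup_le_of_eventually_le (b := ((c * b ^ L : ℝ≥0) : ℝ≥0∞))
    ENNReal.coe_ne_top (Eventually.of_forall fun N => ?_)
  simp only [Dynamics.netMaxcard, ENat.toENNReal_iSup, iSup_le_iff]
  intro F hF
  have hcard : (F.card : ℝ≥0) ≤ c * b ^ L * b ^ N :=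
    (hc (N + L) F (hL N F hF)).trans_eq (by ring)
  simpa using ENNReal.coe_le_coe.2 hcard

namespace ZPlusAction

theorem commute_of_generator_eq_torusEndomorphism {k n : ℕ}
    {T : ZPlusAction k (UnitAddTorus (Fin n))} {A : Fin k → Matrix (Fin n) (Fin n) ℤ}
    (hT : ∀ i, ⇑(T.generator i) = torusEndomorphism (A i)) (i j : Fin k) :
    Commute (A i) (A j) := by
  refine torusEndomorphism_injective ?_
  rw [torusEndomorphism_mul, torusEndomorphism_mul, ← hT, ← hT, ← ContinuousMap.coe_comp,
    ← ContinuousMap.coe_comp, generator, generator, ← T.map_add, ← T.map_add, add_comm]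

end ZPlusAction

namespace OrbitSpace

/-- `s` is an itinerary of the orbit `x` up to time `M`: the `j`-th step of `x` is made by the
generator `T_{s j}`, for all `j < M`. -/
def Follows {k : ℕ} {X : Type*} [TopologicalSpace X] {T : ZPlusAction k X} (x : OrbitSpace T)
    (s : ℕ → Fin k) (M : ℕ) : Prop :=
  ∀ j < M, T.generator (s j) (x.seq j) = x.seq (j + 1)

variable {k n : ℕ} {T : ZPlusAction k (UnitAddTorus (Fin n))}
  {A : Fin k → Matrix (Fin n) (Fin n) ℤ}

theorem Follows.seq_eq (hT : ∀ i, ⇑(T.generator i) = torusEndomorphism (A i))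
    {x : OrbitSpace T} {s : ℕ → Fin k} {M m : ℕ} (hx : x.Follows s M) (hm : m ≤ M) :
    x.seq m = torusEndomorphism (wordProd A s m) (x.seq 0) := by
  induction m with
  | zero => simp [torusEndomorphism_one]
  | succ m ih =>
    rw [← hx m hm, hT, ih (by omega), wordProd_succ, torusEndomorphism_mul, Function.comp_apply]

theorem Follows.dist_seq_le (hT : ∀ i, ⇑(T.generator i) = torusEndomorphism (A i)) {D : ℝ}
    {x y : OrbitSpace T} {s : ℕ → Fin k} {m l : ℕ}
    (hD : ∀ v, ‖v‖ ≤ D * ‖castMatrix ℝ (wordProd A (fun j => s (m + j)) l) *ᵥ v‖)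
    (hx : x.Follows s (m + l)) (hy : y.Follows s (m + l)) {u : Fin n → ℝ}
    (hu : torusProj n u = x.seq 0 - y.seq 0) :
    dist (x.seq m) (y.seq m) ≤ D * ‖castMatrix ℝ (wordProd A s (m + l)) *ᵥ u‖ :=
  calc dist (x.seq m) (y.seq m) = ‖torusProj n (castMatrix ℝ (wordProd A s m) *ᵥ u)‖ := by
        rw [dist_eq_norm, hx.seq_eq hT (by omega), hy.seq_eq hT (by omega),
          ← torusEndomorphism_sub, ← hu, torusEndomorphism_torusProj]
    _ ≤ ‖castMatrix ℝ (wordProd A s m) *ᵥ u‖ := norm_torusProj_le _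
    _ ≤ D * ‖castMatrix ℝ (wordProd A s (m + l)) *ᵥ u‖ := by
        rw [wordProd_add, map_mul, ← mulVec_mulVec]
        exact hD _

theorem IsSeparated.card_le_of_follows (hT : ∀ i, ⇑(T.generator i) = torusEndomorphism (A i))
    (hdet : ∀ i, (A i).det ≠ 0) {δ D : ℝ} (hD0 : 0 ≤ D) {M : ℕ}
    (hD : ∀ s, ∀ l ≤ M, ∀ v, ‖v‖ ≤ D * ‖castMatrix ℝ (wordProd A s l) *ᵥ v‖)
    {K : ℕ} (hK : K ≠ 0) (hDK : D ≤ K * δ) {F : Finset (OrbitSpace T)}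
    (hF : IsSeparated δ M (F : Set (OrbitSpace T))) {s : ℕ → Fin k} (hs : ∀ x ∈ F, x.Follows s M) :
    F.card ≤ K ^ n * ∏ j ∈ Finset.range M, (A (s j)).det.natAbs := by
  have hdetK : ((K : ℤ) • wordProd A s M).det ≠ 0 := by
    rw [← Int.natAbs_ne_zero, natAbs_det_natCast_smul_wordProd]
    exact mul_ne_zero (by positivity)
      (Finset.prod_ne_zero_iff.2 fun j _ => Int.natAbs_ne_zero.2 (hdet (s j)))
  have hcard := card_quotient_range_toLin' _ hdetK
  have := Nat.finite_of_card_ne_zero (hcard ▸ Int.natAbs_ne_zero.2 hdetK)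
  obtain ⟨c, hc⟩ := exists_coding_mod_range_toLin' (wordProd A s M) hK
  have hinj : Set.InjOn (fun x : OrbitSpace T => c (x.seq 0)) F := by
    intro x hx y hy hxy
    by_contra hne
    obtain ⟨u, hu, huB⟩ := hc _ _ hxy
    obtain ⟨m, hm, hsep⟩ := hF hx hy hne
    obtain ⟨l, rfl⟩ := Nat.exists_eq_add_of_lt hm
    have hle := Follows.dist_seq_le hT (hD _ (l + 1) (by omega)) (hs x hx) (hs y hy) hu
    refine hsep.not_ge (hle.trans ((mul_le_mul_of_nonneg_left huB hD0).trans ?_))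
    rwa [mul_one_div, div_le_iff₀' (by positivity)]
  rw [← natAbs_det_natCast_smul_wordProd, ← hcard, ← Set.ncard_coe_finset, ← hinj.ncard_image]
  exact Set.ncard_le_card _

theorem IsSeparated.card_le (hT : ∀ i, ⇑(T.generator i) = torusEndomorphism (A i))
    (hdet : ∀ i, (A i).det ≠ 0) {δ D : ℝ} (hD0 : 0 ≤ D) {M : ℕ}
    (hD : ∀ s, ∀ l ≤ M, ∀ v, ‖v‖ ≤ D * ‖castMatrix ℝ (wordProd A s l) *ᵥ v‖)
    {K : ℕ} (hK : K ≠ 0) (hDK : D ≤ K * δ) {F : Finset (OrbitSpace T)}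
    (hF : IsSeparated δ M (F : Set (OrbitSpace T))) :
    F.card ≤ K ^ n * (∑ i, (A i).det.natAbs) ^ M := by
  classical
  choose s hs using fun x : OrbitSpace T => x.step
  let word (x : OrbitSpace T) (j : Fin M) : Fin k := s x j
  have hfiber (w : Fin M → Fin k) :
      (F.filter (word · = w)).card ≤ K ^ n * ∏ j, (A (w j)).det.natAbs := by
    obtain hempty | ⟨x₀, hx₀⟩ := (F.filter (word · = w)).eq_empty_or_nonempty
    · simp [hempty]
    obtain rfl : word x₀ = w := (Finset.mem_filter.1 hx₀).2
    rw [← Finset.prod_range fun j => (A (s x₀ j)).det.natAbs]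
    refine IsSeparated.card_le_of_follows hT hdet hD0 hD hK hDK
      (hF.mono (Finset.coe_subset.2 (Finset.filter_subset _ _))) fun x hx j hj => ?_
    have hsj : s x j = s x₀ j := congrFun (Finset.mem_filter.1 hx).2 ⟨j, hj⟩
    exact hsj ▸ hs x j
  calc F.card = ∑ w, (F.filter (word · = w)).card :=
        Finset.card_eq_sum_card_fiberwise fun _ _ => Finset.mem_univ _
    _ ≤ ∑ w : Fin M → Fin k, K ^ n * ∏ j, (A (w j)).det.natAbs :=
        Finset.sum_le_sum fun w _ => hfiber w
    _ = K ^ n * (∑ i, (A i).det.natAbs) ^ M := by rw [← Finset.mul_sum, Fintype.sum_pow]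

theorem exists_card_le_mul_pow_of_isSeparated
    (hT : ∀ i, ⇑(T.generator i) = torusEndomorphism (A i))
    (hexp : ∀ i, ∀ μ ∈ complexEigenvalues (A i), 1 ≤ ‖μ‖) {r : ℝ≥0} (hr : 1 < r) {δ : ℝ}
    (hδ : 0 < δ) :
    ∃ c : ℝ≥0, ∀ (M : ℕ) (F : Finset (OrbitSpace T)), IsSeparated δ M (F : Set (OrbitSpace T)) →
      (F.card : ℝ≥0) ≤ c * (r ^ n * ∑ i, ((A i).det.natAbs : ℝ≥0)) ^ M := by
  have hdet (i : Fin k) : (A i).det ≠ 0 := det_ne_zero_of_zero_notMem_complexEigenvalues _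
    fun h0 => (norm_zero (E := ℂ) ▸ hexp i 0 h0).not_gt one_pos
  obtain ⟨C, hC⟩ := exists_norm_le_mul_norm_castMatrix_wordProd_mulVec
    (ZPlusAction.commute_of_generator_eq_torusEndomorphism hT) hexp hr
  obtain ⟨c, hc⟩ : ∃ c : ℝ≥0, (c : ℝ) = |C| / δ := ⟨⟨_, by positivity⟩, rfl⟩
  refine ⟨(c + 1) ^ n, fun M F hF => ?_⟩
  have hrM : (1 : ℝ≥0) ≤ r ^ M := one_le_pow₀ hr.le
  have hD (s : ℕ → Fin k) (l : ℕ) (hl : l ≤ M) (v : Fin n → ℝ) :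
      ‖v‖ ≤ |C| * r ^ M * ‖castMatrix ℝ (wordProd A s l) *ᵥ v‖ := by
    refine (hC s l v).trans ?_
    gcongr
    · exact le_abs_self C
    · exact_mod_cast hr.le
  set K := ⌊c * r ^ M⌋₊ + 1 with hK
  have hDK : |C| * r ^ M ≤ K * δ := by
    have hlt : (c * r ^ M : ℝ) < K := by exact_mod_cast Nat.lt_floor_add_one (c * r ^ M)
    rw [hc, div_mul_eq_mul_div, div_lt_iff₀ hδ] at hlt
    exact hlt.le
  have hKle : (K : ℝ≥0) ≤ (c + 1) * r ^ M := by
    rw [hK, Nat.cast_succ, add_one_mul]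
    exact add_le_add (Nat.floor_le (by positivity)) hrM
  calc (F.card : ℝ≥0) ≤ K ^ n * (∑ i, ((A i).det.natAbs : ℝ≥0)) ^ M := by
        exact_mod_cast hF.card_le hT hdet (by positivity) hD (Nat.succ_ne_zero _) hDK
    _ ≤ ((c + 1) * r ^ M) ^ n * (∑ i, ((A i).det.natAbs : ℝ≥0)) ^ M := by gcongr
    _ = (c + 1) ^ n * (r ^ n * ∑ i, ((A i).det.natAbs : ℝ≥0)) ^ M := by
        rw [mul_pow, mul_pow, mul_assoc, pow_right_comm]

end OrbitSpace

theorem theorem4p1_general {k n : ℕ} (A : Fin k → Matrix (Fin n) (Fin n) ℤ)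
    (T : ZPlusAction k (UnitAddTorus (Fin n)))
    (hT : ∀ i : Fin k, ⇑(T.generator i) = torusEndomorphism (A i))
    (hexp : ∀ i : Fin k, ∀ μ ∈ complexEigenvalues (A i), 1 ≤ ‖μ‖) :
    friedlandEntropy T ≤ (Real.log (∑ i : Fin k, |((A i).det : ℝ)|) : ℝ) := by
  set S : ℝ≥0 := ∑ i, ((A i).det.natAbs : ℝ≥0) with hS
  have hle : ∀ r : ℝ≥0, 1 < r → friedlandEntropy T ≤ ENNReal.log (r ^ n * S : ℝ≥0) := fun r hr =>
    friedlandEntropy_le_log_of_forall_isSeparated fun δ hδ =>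
      OrbitSpace.exists_card_le_mul_pow_of_isSeparated hT hexp hr hδ
  have hlim : Tendsto (fun r : ℝ≥0 => ENNReal.log (r ^ n * S : ℝ≥0)) (𝓝[>] 1)
      (𝓝 (ENNReal.log S)) := by
    have hcont : Continuous fun r : ℝ≥0 => ENNReal.log (r ^ n * S : ℝ≥0) :=
      ENNReal.continuous_log.comp (by fun_prop)
    simpa using (hcont.tendsto 1).mono_left nhdsWithin_le_nhds
  calc friedlandEntropy T ≤ ENNReal.log S :=
        ge_of_tendsto hlim (eventually_nhdsWithin_of_forall hle)
    _ ≤ Real.log S := by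
        rw [← ENNReal.ofReal_coe_nnreal, ENNReal.log_ofReal]
        split_ifs
        exacts [bot_le, le_rfl]
    _ = Real.log (∑ i : Fin k, |((A i).det : ℝ)|) := by simp [hS, Nat.cast_natAbs]

theorem theorem4p1 {k n : ℕ} (A : Fin k → Matrix (Fin n) (Fin n) ℤ)
    (T : ZPlusAction k (UnitAddTorus (Fin n)))
    (hT : ∀ i : Fin k, ⇑(T.generator i) = torusEndomorphism (A i))
    (hdiff : Pairwise fun i j => A i ≠ A j)
    (hns : ∀ i : Fin k, (A i).det ≠ 0)
    (hexp : ∀ i : Fin k, ∀ μ ∈ complexEigenvalues (A i), 1 < ‖μ‖) :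
    friedlandEntropy T ≤
        ((Real.log (∑ i : Fin k, ((complexEigenvalues (A i)).map fun μ => ‖μ‖).prod) : ℝ) : EReal) ∧
      Real.log (∑ i : Fin k, ((complexEigenvalues (A i)).map fun μ => ‖μ‖).prod) =
        Real.log (∑ i : Fin k, |((A i).det : ℝ)|) := by
  simpa only [prod_norm_complexEigenvalues, and_true] using
    theorem4p1_general A T hT fun i μ hμ => (hexp i μ hμ).le
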